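/- Let $D\ge 2$ and let $K\subseteq\mathbb{R}^D$ be a convex set with non-empty interior (not necessarily closed or bounded) that is $o$-symmetric, i.e. $K=-K$. Call two sets non-overlapping if their interiors are disjoint. Let $\alpha>0$ and $t_1,\dots,t_n\in\mathbb{R}^D$ be such that the translates $\alpha K+t_1,\dots,\alpha K+t_n$ are pairwise non-overlapping, each of them intersects $K$, and the origin $o$ is not in the interior of $\operatorname{conv}\{t_1,\dots,t_n\}$. Then $$ n\le\frac{(1+2\alpha)^{D-1}(1+3\alpha)}{2\alpha^D}. $$ For $\alpha=1$ the bound is sharp in every dimension $D\ge2$: there are a compact $o$-symmetric convex set $K\subseteq\mathbb{R}^D$ with non-empty interior and $n=2\cdot 3^{D-1}$ vectors $t_1,\dots,t_n$ satisfying the above conditions with $\alpha=1$, so that equality holds. -/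

import Mathlib

open scoped Pointwise

/-- Two sets are non-overlapping if their interiors are disjoint. -/
def NonOverlapping {E : Type*} [TopologicalSpace E] (A B : Set E) : Prop :=
  Disjoint (interior A) (interior B)

/-- A convex set `K` with non-empty interior that is symmetric about the origin; it need not be
closed or bounded. -/
structure IsSymmConvexSet {D : ℕ} (K : Set (EuclideanSpace ℝ (Fin D))) : Prop where
  convex : Convex ℝ K
  symm : -K = K
  interior_nonempty : (interior K).Nonempty

/-- The sets `αK + t₁, …, αK + tₙ` are pairwise non-overlapping, each of them meets `K`, and the
origin is not an interior point of the convex hull of `t₁, …, tₙ`. -/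
structure IsOneSidedArrangement {D n : ℕ} (K : Set (EuclideanSpace ℝ (Fin D))) (α : ℝ)
    (t : Fin n → EuclideanSpace ℝ (Fin D)) : Prop where
  nonOverlapping : ∀ i j, i ≠ j → NonOverlapping (t i +ᵥ α • K) (t j +ᵥ α • K)
  meets : ∀ i, ((t i +ᵥ α • K) ∩ K).Nonempty
  oneSided : (0 : EuclideanSpace ℝ (Fin D)) ∉ interior (convexHull ℝ (Set.range t))

/-- The number `(1 + 2α)^(D-1) (1 + 3α) / (2 α^D)`. -/
noncomputable def oneSidedBound (D : ℕ) (α : ℝ) : ℝ :=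
  (1 + 2 * α) ^ (D - 1) * (1 + 3 * α) / (2 * α ^ D)

/-!
Upper bound. All `tᵢ` lie in a closed half-space `f ≥ 0`, and `f` may be taken as the first
coordinate, the height. After `K` is cut down to a bounded set and replaced by its interior `U`, the
translates `αU + tᵢ` are pairwise disjoint subsets of `(1 + 2α)U`. Comparing volumes in the
half-space `f ≥ -α max f` is not enough, because the sections of `U` of small height may be large.
Instead, the sets are compared in the measure `ν` that is Lebesgue measure on the half-space
`f ≥ 0` plus a multiple `m` of `(D - 1)`-dimensional Lebesgue measure on the hyperplane `f = 0`.

Let `A x` be the volume of the section of `U` at height `x`, let `G = ∫₀^∞ A`, and take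
`m = α G / A 0`. Then `ν ((1 + 2α)U) = (1 + 2α) ^ (D - 1) (1 + 3α) G`. A translate of `αU` whose
centre has height `αs ≥ 0` has `ν`-measure `α ^ D (∫_{-s}^∞ A + (G / A 0) A s)`, which is at least
`2 α ^ D G`, the volume of `αU`, as soon as `∫_s^∞ A ≤ (G / A 0) A s`
(`IsLogConcave.two_mul_setLIntegral_le`). Integrated over `y ≥ 0`, the inequality
`A (s + y) A 0 ≤ A s A y` gives just that, and it holds because `A` is log-concave
(`IsLogConcave.mul_apply_zero_le`). The bound follows by adding up the measures of the translates
(`card_mul_le_of_pairwise_disjoint_translates`).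

Log-concavity of `A` is the multiplicative Brunn–Minkowski inequality. It is obtained here from
Prékopa's theorem (`IsLogConcave.lintegral_pi`): marginals of log-concave functions are log-concave,
which follows by integrating out one coordinate at a time with the one-dimensional
Prékopa–Leindler inequality (`prekopa_leindler`).

Sharpness for `α = 1`. For the cube `[-1, 1] ^ D`, take the translations by the vectors in
`{0, 2} × {-2, 0, 2} ^ (D - 1)`.
-/

open MeasureTheory Set
open scoped ENNReal

/-! ### The Prékopa–Leindler inequality on the line -/

/-- The Brunn–Minkowski inequality on the line. For compact sets, the translates `K + min L` and
`max K + L` both lie in `K + L` and overlap in one point. -/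
theorem volume_add_volume_le_of_add_mem {A B C : Set ℝ} (hA : MeasurableSet A)
    (hB : MeasurableSet B) (hA0 : A.Nonempty) (hB0 : B.Nonempty)
    (h : ∀ x ∈ A, ∀ y ∈ B, x + y ∈ C) : volume A + volume B ≤ volume C := by
  have key : ∀ K, IsCompact K → K ⊆ A → K.Nonempty → ∀ L, IsCompact L → L ⊆ B → L.Nonempty →
      volume K + volume L ≤ volume C := by
    intro K hK hKA hK0 L hL hLB hL0
    obtain ⟨p, hp, hpmax⟩ := hK.exists_isGreatest hK0
    obtain ⟨q, hq, hqmin⟩ := hL.exists_isLeast hL0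
    have e1 : volume K = volume ((fun x => x + q) '' K) := by simp
    have e2 : volume L = volume ((fun y => p + y) '' L) := by simp
    rw [e1, e2, ← measure_union₀]
    · apply measure_mono
      rintro _ (⟨x, hx, rfl⟩ | ⟨y, hy, rfl⟩)
      · exact h _ (hKA hx) _ (hLB hq)
      · exact h _ (hKA hp) _ (hLB hy)
    · exact (hL.image (by fun_prop)).measurableSet.nullMeasurableSet
    · refine measure_mono_null (t := {p + q}) ?_ (by simp)
      rintro _ ⟨⟨x, hx, rfl⟩, ⟨y, hy, hxy⟩⟩
      have h1 := hpmax hx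
      have h2 := hqmin hy
      simp only [mem_singleton_iff] at hxy ⊢
      linarith
  obtain ⟨x0, hx0⟩ := hA0
  obtain ⟨y0, hy0⟩ := hB0
  rw [hA.measure_eq_iSup_isCompact, hB.measure_eq_iSup_isCompact]
  simp only [iSup_and']
  refine ENNReal.biSup_add_biSup_le' ⟨∅, by simp⟩ ⟨∅, by simp⟩ ?_
  rintro K ⟨hKA, hK⟩ L ⟨hLB, hL⟩
  -- inserting a point makes the compact sets non-empty
  calc volume K + volume L ≤ volume (insert x0 K) + volume (insert y0 L) := by
        gcongr <;> exact subset_insert _ _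
    _ ≤ volume C := key _ (hK.insert _) (insert_subset hx0 hKA) (insert_nonempty _ _)
        _ (hL.insert _) (insert_subset hy0 hLB) (insert_nonempty _ _)

theorem volume_convexComb_le {A B C : Set ℝ} (hA : MeasurableSet A)
    (hB : MeasurableSet B) (hA0 : A.Nonempty) (hB0 : B.Nonempty) {a b : ℝ} (ha : 0 < a)
    (hb : 0 < b) (h : ∀ x ∈ A, ∀ y ∈ B, a * x + b * y ∈ C) :
    ENNReal.ofReal a * volume A + ENNReal.ofReal b * volume B ≤ volume C := by
  have e : ∀ (c : ℝ) (S : Set ℝ), 0 < c → ENNReal.ofReal c * volume S = volume (c • S) := by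
    intro c S hc
    rw [Measure.addHaar_smul]
    simp [abs_of_pos hc]
  rw [e a A ha, e b B hb]
  refine volume_add_volume_le_of_add_mem (hA.const_smul₀ a) (hB.const_smul₀ b) hA0.smul_set
    hB0.smul_set ?_
  rintro _ ⟨x, hx, rfl⟩ _ ⟨y, hy, rfl⟩
  exact h x hx y hy

theorem ENNReal.rpow_mul_rpow_le_weighted_add {a b : ℝ} (ha : 0 < a) (hb : 0 < b)
    (hab : a + b = 1) (x y : ℝ≥0∞) :
    x ^ a * y ^ b ≤ ENNReal.ofReal a * x + ENNReal.ofReal b * y := by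
  rcases eq_or_ne x ⊤ with rfl | hx
  · simp [ENNReal.mul_top, ha]
  rcases eq_or_ne y ⊤ with rfl | hy
  · simp [ENNReal.mul_top, hb]
  lift x to NNReal using hx
  lift y to NNReal using hy
  lift a to NNReal using ha.le
  lift b to NNReal using hb.le
  have := NNReal.geom_mean_le_arith_mean2_weighted a b x y (by exact_mod_cast hab)
  rw [← ENNReal.coe_rpow_of_nonneg _ a.coe_nonneg, ← ENNReal.coe_rpow_of_nonneg _ b.coe_nonneg,
    ENNReal.ofReal_coe_nnreal, ENNReal.ofReal_coe_nnreal]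
  exact_mod_cast this

theorem lintegral_eq_lintegral_meas_ofReal_lt {f : ℝ → ℝ≥0∞} (hf : Measurable f)
    (hfin : ∀ x, f x ≠ ⊤) :
    ∫⁻ x, f x = ∫⁻ t in Ioi (0 : ℝ), volume {x | ENNReal.ofReal t < f x} := by
  have := lintegral_eq_lintegral_meas_lt (volume : Measure ℝ) (f := fun x => (f x).toReal)
    (Filter.Eventually.of_forall fun x => ENNReal.toReal_nonneg) hf.ennreal_toReal.aemeasurable
  simp only [ENNReal.ofReal_toReal (hfin _)] at this
  rw [this]
  refine setLIntegral_congr_fun measurableSet_Ioi fun t ht => ?_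
  simp only [ENNReal.ofReal_lt_iff_lt_toReal (le_of_lt ht) (hfin _)]

/-- The Prékopa–Leindler inequality on the line for functions with supremum one, in its stronger
additive form: every superlevel set of `h` contains a convex combination of non-empty superlevel
sets of `f` and `g`. -/
theorem prekopa_leindler_of_iSup_eq_one {f g h : ℝ → ℝ≥0∞} (hf : Measurable f)
    (hg : Measurable g) (hh : Measurable h) (hf1 : ⨆ x, f x = 1) (hg1 : ⨆ x, g x = 1)
    {a b : ℝ} (ha : 0 < a) (hb : 0 < b) (hab : a + b = 1)
    (hfgh : ∀ x y, f x ^ a * g y ^ b ≤ h (a * x + b * y)) :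
    ENNReal.ofReal a * (∫⁻ x, f x) + ENNReal.ofReal b * (∫⁻ x, g x) ≤ ∫⁻ x, h x := by
  have hfle : ∀ x, f x ≤ 1 := fun x => hf1 ▸ le_iSup f x
  have hgle : ∀ x, g x ≤ 1 := fun x => hg1 ▸ le_iSup g x
  have ntop : ∀ {z : ℝ≥0∞}, z ≤ 1 → z ≠ ⊤ := fun hz => ne_top_of_le_ne_top ENNReal.one_ne_top hz
  calc ENNReal.ofReal a * (∫⁻ x, f x) + ENNReal.ofReal b * (∫⁻ x, g x)
      ≤ ∫⁻ x, min (h x) 1 := by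
        rw [lintegral_eq_lintegral_meas_ofReal_lt hf fun x => ntop (hfle x),
          lintegral_eq_lintegral_meas_ofReal_lt hg fun x => ntop (hgle x),
          lintegral_eq_lintegral_meas_ofReal_lt (hh.min measurable_const)
            fun x => ntop (min_le_right _ _)]
        refine (add_le_add (lintegral_const_mul_le _ _) (lintegral_const_mul_le _ _)).trans ?_
        refine (le_lintegral_add _ _).trans ?_
        refine lintegral_mono fun t => ?_
        by_cases ht : ENNReal.ofReal t < 1
        · obtain ⟨x0, hx0⟩ := lt_iSup_iff.1 (hf1.symm ▸ ht)
          obtain ⟨y0, hy0⟩ := lt_iSup_iff.1 (hg1.symm ▸ ht)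
          refine volume_convexComb_le (measurableSet_lt measurable_const hf)
            (measurableSet_lt measurable_const hg) ⟨x0, hx0⟩ ⟨y0, hy0⟩ ha hb ?_
          intro x hx y hy
          refine lt_min (lt_of_lt_of_le ?_ (hfgh x y)) ht
          calc ENNReal.ofReal t = ENNReal.ofReal t ^ a * ENNReal.ofReal t ^ b := by
                rw [← ENNReal.rpow_add_of_nonneg _ _ ha.le hb.le, hab, ENNReal.rpow_one]
            _ < f x ^ a * g y ^ b :=
                ENNReal.mul_lt_mul (ENNReal.rpow_lt_rpow hx ha) (ENNReal.rpow_lt_rpow hy hb)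
        · have e1 : {x | ENNReal.ofReal t < f x} = ∅ :=
            eq_empty_of_forall_notMem fun x hx => ht (lt_of_lt_of_le hx (hfle x))
          have e2 : {x | ENNReal.ofReal t < g x} = ∅ :=
            eq_empty_of_forall_notMem fun x hx => ht (lt_of_lt_of_le hx (hgle x))
          simp [e1, e2]
    _ ≤ ∫⁻ x, h x := lintegral_mono fun x => min_le_left _ _

theorem prekopa_leindler_of_iSup_ne_top {f g h : ℝ → ℝ≥0∞} (hf : Measurable f)
    (hg : Measurable g) (hh : Measurable h) (hf1 : ⨆ x, f x ≠ ⊤) (hg1 : ⨆ x, g x ≠ ⊤)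
    {a b : ℝ} (ha : 0 < a) (hb : 0 < b) (hab : a + b = 1)
    (hfgh : ∀ x y, f x ^ a * g y ^ b ≤ h (a * x + b * y)) :
    (∫⁻ x, f x) ^ a * (∫⁻ x, g x) ^ b ≤ ∫⁻ x, h x := by
  rcases eq_or_ne (⨆ x, f x) 0 with hf0 | hf0
  · have : ∀ x, f x = 0 := fun x => le_antisymm (hf0 ▸ le_iSup f x) bot_le
    simp [this, ha]
  rcases eq_or_ne (⨆ x, g x) 0 with hg0 | hg0
  · have : ∀ x, g x = 0 := fun x => le_antisymm (hg0 ▸ le_iSup g x) bot_le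
    simp [this, hb]
  set F := ⨆ x, f x
  set G := ⨆ x, g x
  have hFG0 : F ^ a * G ^ b ≠ 0 := by simp [hf0, hg0, hf1, hg1]
  have hFGt : F ^ a * G ^ b ≠ ⊤ :=
    ENNReal.mul_ne_top (ENNReal.rpow_ne_top_of_nonneg ha.le hf1)
      (ENNReal.rpow_ne_top_of_nonneg hb.le hg1)
  have hinv : (F ^ a * G ^ b)⁻¹ = F⁻¹ ^ a * G⁻¹ ^ b := by
    rw [ENNReal.mul_inv (Or.inr (ENNReal.rpow_ne_top_of_nonneg hb.le hg1))
      (Or.inl (ENNReal.rpow_ne_top_of_nonneg ha.le hf1)), ENNReal.inv_rpow, ENNReal.inv_rpow]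
  have key := prekopa_leindler_of_iSup_eq_one (f := fun x => F⁻¹ * f x) (g := fun x => G⁻¹ * g x)
    (h := fun x => (F ^ a * G ^ b)⁻¹ * h x) (hf.const_mul _) (hg.const_mul _) (hh.const_mul _)
    (by rw [← ENNReal.mul_iSup]; exact ENNReal.inv_mul_cancel hf0 hf1)
    (by rw [← ENNReal.mul_iSup]; exact ENNReal.inv_mul_cancel hg0 hg1) ha hb hab (by
      intro x y
      rw [ENNReal.mul_rpow_of_nonneg _ _ ha.le, ENNReal.mul_rpow_of_nonneg _ _ hb.le,
        mul_mul_mul_comm, hinv]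
      gcongr
      exact hfgh x y)
  have key2 := (ENNReal.rpow_mul_rpow_le_weighted_add ha hb hab _ _).trans key
  rw [lintegral_const_mul _ hf, lintegral_const_mul _ hg, lintegral_const_mul _ hh,
    ENNReal.mul_rpow_of_nonneg _ _ ha.le, ENNReal.mul_rpow_of_nonneg _ _ hb.le,
    mul_mul_mul_comm, ← hinv] at key2
  exact (ENNReal.mul_le_mul_iff_right (ENNReal.inv_ne_zero.2 hFGt)
    (ENNReal.inv_ne_top.2 hFG0)).1 key2

theorem lintegral_eq_iSup_lintegral_min_natCast {f : ℝ → ℝ≥0∞} (hf : Measurable f) :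
    ∫⁻ x, f x = ⨆ N : ℕ, ∫⁻ x, min (f x) N := by
  rw [← lintegral_iSup (fun N => hf.min measurable_const)]
  · refine lintegral_congr fun x => ?_
    have := inf_iSup_eq (f x) (fun n : ℕ => (n : ℝ≥0∞))
    rw [ENNReal.iSup_natCast] at this
    simpa using this
  · intro M N hMN x
    exact min_le_min le_rfl (by exact_mod_cast hMN)

/-- The Prékopa–Leindler inequality on the line. -/
theorem prekopa_leindler {f g h : ℝ → ℝ≥0∞} (hf : Measurable f)
    (hg : Measurable g) (hh : Measurable h)
    {a b : ℝ} (ha : 0 < a) (hb : 0 < b) (hab : a + b = 1)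
    (hfgh : ∀ x y, f x ^ a * g y ^ b ≤ h (a * x + b * y)) :
    (∫⁻ x, f x) ^ a * (∫⁻ x, g x) ^ b ≤ ∫⁻ x, h x := by
  have hpow : ∀ (c : ℝ), 0 < c → ∀ u : ℕ → ℝ≥0∞, (⨆ N, u N) ^ c = ⨆ N, u N ^ c :=
    fun c hc u => (ENNReal.orderIsoRpow c hc).map_iSup u
  have hbdd : ∀ (k : ℝ → ℝ≥0∞) (N : ℕ), ⨆ x, min (k x) N ≠ ⊤ := fun k N =>
    ne_top_of_le_ne_top (ENNReal.natCast_ne_top N) (iSup_le fun x => min_le_right _ _)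
  rw [lintegral_eq_iSup_lintegral_min_natCast hf, lintegral_eq_iSup_lintegral_min_natCast hg,
    hpow a ha, hpow b hb, ENNReal.iSup_mul]
  refine iSup_le fun M => ?_
  rw [ENNReal.mul_iSup]
  refine iSup_le fun N => ?_
  refine prekopa_leindler_of_iSup_ne_top (hf.min measurable_const) (hg.min measurable_const) hh
    (hbdd f M) (hbdd g N) ha hb hab fun x y => le_trans ?_ (hfgh x y)
  gcongr <;> exact min_le_left _ _

/-! ### Log-concave functions and their marginals -/

/-- A function with values in `[0, ∞]` is log-concave if it is at least the weighted geometric mean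
of its values at the endpoints on every segment. The weights are positive, so that `0 ^ 0` does not
occur. -/
def IsLogConcave {E : Type*} [AddCommGroup E] [Module ℝ E] (f : E → ℝ≥0∞) : Prop :=
  ∀ ⦃x y : E⦄ ⦃a b : ℝ⦄, 0 < a → 0 < b → a + b = 1 → f x ^ a * f y ^ b ≤ f (a • x + b • y)

theorem Convex.isLogConcave_indicator_one {E : Type*} [AddCommGroup E] [Module ℝ E] {s : Set E}
    (hs : Convex ℝ s) : IsLogConcave (s.indicator (1 : E → ℝ≥0∞)) := by
  intro x y a b ha hb hab
  by_cases hx : x ∈ s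
  · by_cases hy : y ∈ s
    · simp [hx, hy, hs hx hy ha.le hb.le hab]
    · simp [hy, hb]
  · simp [hx, ha]

/-- Prékopa's theorem for one variable. -/
theorem IsLogConcave.lintegral_real {E : Type*} [AddCommGroup E] [Module ℝ E] [MeasurableSpace E]
    {f : E × ℝ → ℝ≥0∞} (hf : IsLogConcave f) (hm : Measurable f) :
    IsLogConcave fun x => ∫⁻ u, f (x, u) := by
  intro x y a b ha hb hab
  exact prekopa_leindler (hm.comp measurable_prodMk_left) (hm.comp measurable_prodMk_left)
    (hm.comp measurable_prodMk_left) ha hb hab fun u v => hf ha hb hab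

/-- Prékopa's theorem: the marginals of a log-concave function are log-concave. -/
theorem IsLogConcave.lintegral_pi (n : ℕ) :
    ∀ {E : Type} [AddCommGroup E] [Module ℝ E] [MeasurableSpace E]
      {f : E × (Fin n → ℝ) → ℝ≥0∞}, IsLogConcave f → Measurable f →
      IsLogConcave fun x => ∫⁻ v, f (x, v) := by
  induction n with
  | zero =>
    intro E _ _ _ f hf _ x y a b ha hb hab
    have hone : (volume : Measure (Fin 0 → ℝ)) univ = 1 := by simp [volume_pi]
    simp only [lintegral_unique, hone, mul_one]
    refine le_trans (hf ha hb hab) (le_of_eq ?_)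
    exact congrArg f (Prod.ext rfl (Subsingleton.elim (α := Fin 0 → ℝ) _ _))
  | succ n ih =>
    intro E _ _ _ f hf hm
    have hcons : Measurable fun q : (E × ℝ) × (Fin n → ℝ) =>
        (q.1.1, (Fin.cons q.1.2 q.2 : Fin (n + 1) → ℝ)) := by
      refine measurable_fst.fst.prodMk (measurable_pi_lambda _ fun i => ?_)
      refine Fin.cases ?_ (fun j => ?_) i
      · simpa using measurable_fst.snd
      · simpa [Function.comp_def] using (measurable_pi_apply j).comp measurable_snd
    have h1 : IsLogConcave fun p : E × ℝ => ∫⁻ v, f (p.1, (Fin.cons p.2 v : Fin (n + 1) → ℝ)) := by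
      refine ih (f := fun q : (E × ℝ) × (Fin n → ℝ) =>
        f (q.1.1, (Fin.cons q.1.2 q.2 : Fin (n + 1) → ℝ))) ?_ (hm.comp hcons)
      intro p q a b ha hb hab
      have := hf (x := (p.1.1, (Fin.cons p.1.2 p.2 : Fin (n + 1) → ℝ)))
        (y := (q.1.1, (Fin.cons q.1.2 q.2 : Fin (n + 1) → ℝ))) ha hb hab
      refine this.trans (le_of_eq (congrArg f (Prod.ext rfl (funext fun i => ?_))))
      refine Fin.cases ?_ (fun j => ?_) i <;> simp
    have h2 := h1.lintegral_real ((hm.comp hcons).lintegral_prod_right')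
    convert h2 using 2 with x
    have hmx : Measurable fun v : Fin (n + 1) → ℝ => f (x, v) := hm.comp measurable_prodMk_left
    rw [← (volume_preserving_piFinSuccAbove (fun _ : Fin (n + 1) => ℝ) 0).symm.lintegral_comp hmx]
    rw [Measure.volume_eq_prod, lintegral_prod _ (by fun_prop)]
    simp [MeasurableEquiv.piFinSuccAbove, Fin.insertNthEquiv]

/-! ### Even log-concave functions on the line -/

theorem lintegral_eq_ofReal_mul_lintegral_comp_affine {g : ℝ → ℝ≥0∞} (hg : Measurable g) {c : ℝ}
    (hc : 0 < c) (u : ℝ) :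
    ∫⁻ x, g x = ENNReal.ofReal c * ∫⁻ x, g (c * x + u) := by
  rw [← lintegral_add_right_eq_self g u]
  conv_lhs => rw [← Real.smul_map_volume_mul_left hc.ne']
  rw [lintegral_smul_measure, lintegral_map (by fun_prop) (by fun_prop), abs_of_pos hc,
    smul_eq_mul]

theorem setLIntegral_Ici_eq_ofReal_mul {g : ℝ → ℝ≥0∞} (hg : Measurable g) {c : ℝ}
    (hc : 0 < c) (u w : ℝ) :
    ∫⁻ x in Ici w, g x = ENNReal.ofReal c * ∫⁻ x in Ici ((w - u) / c), g (c * x + u) := by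
  rw [← lintegral_indicator measurableSet_Ici, ← lintegral_indicator measurableSet_Ici,
    lintegral_eq_ofReal_mul_lintegral_comp_affine (hg.indicator measurableSet_Ici) hc u]
  congr 2 with x
  have : c * x + u ∈ Ici w ↔ x ∈ Ici ((w - u) / c) := by
    rw [mem_Ici, mem_Ici, div_le_iff₀ hc]
    constructor <;> intro h <;> linarith
  by_cases hx : x ∈ Ici ((w - u) / c)
  · rw [indicator_of_mem (this.2 hx), indicator_of_mem hx]
  · rw [indicator_of_notMem (mt this.1 hx), indicator_of_notMem hx]

section EvenLogConcave

variable {A : ℝ → ℝ≥0∞}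

/-- Both `s` and `y` are convex combinations of `s + y` and `0`, with exchanged weights. -/
theorem IsLogConcave.mul_apply_zero_le (hA : IsLogConcave A) {s y : ℝ} (hs : 0 ≤ s) (hy : 0 ≤ y) :
    A (s + y) * A 0 ≤ A s * A y := by
  rcases hs.eq_or_lt with rfl | hs
  · rw [zero_add, mul_comm]
  rcases hy.eq_or_lt with rfl | hy
  · rw [add_zero]
  have h0 : s + y ≠ 0 := by positivity
  have ha : 0 < s / (s + y) := by positivity
  have hb : 0 < y / (s + y) := by positivity
  have hab : s / (s + y) + y / (s + y) = 1 := by field_simp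
  have h1 := hA (x := s + y) (y := 0) ha hb hab
  have h2 := hA (x := s + y) (y := 0) hb ha (by rw [add_comm, hab])
  simp only [smul_eq_mul, mul_zero, add_zero, div_mul_cancel₀ _ h0] at h1 h2
  calc A (s + y) * A 0
      = (A (s + y) ^ (s / (s + y)) * A 0 ^ (y / (s + y))) *
        (A (s + y) ^ (y / (s + y)) * A 0 ^ (s / (s + y))) := by
        rw [mul_mul_mul_comm, ← ENNReal.rpow_add_of_nonneg _ _ ha.le hb.le,
          ← ENNReal.rpow_add_of_nonneg _ _ hb.le ha.le, add_comm (y / (s + y)), hab,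
          ENNReal.rpow_one, ENNReal.rpow_one]
    _ ≤ A s * A y := mul_le_mul' h1 h2

theorem IsLogConcave.setLIntegral_Ici_mul_le (hA : IsLogConcave A) (hm : Measurable A) {s : ℝ}
    (hs : 0 ≤ s) : (∫⁻ x in Ici s, A x) * A 0 ≤ A s * ∫⁻ x in Ici 0, A x := by
  rw [setLIntegral_Ici_eq_ofReal_mul hm one_pos s s, ENNReal.ofReal_one, one_mul, sub_self,
    zero_div, ← lintegral_mul_const _ (by fun_prop), ← lintegral_const_mul _ hm]
  refine setLIntegral_mono (by fun_prop) fun y hy => ?_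
  rw [one_mul, add_comm]
  exact hA.mul_apply_zero_le hs hy

theorem setLIntegral_Iic_neg_of_even (heven : ∀ x, A (-x) = A x) (s : ℝ) :
    ∫⁻ x in Iic (-s), A x = ∫⁻ x in Ici s, A x := by
  have := (Measure.measurePreserving_neg (volume : Measure ℝ)).setLIntegral_comp_preimage_emb
    (MeasurableEquiv.neg ℝ).measurableEmbedding A (Ici s)
  rw [← this]
  simp [heven]

/-- The weight `(∫₀^∞ A) / A 0` at the height `s` makes up for the part of the integral of `A` that
lies beyond `-s`. -/
theorem IsLogConcave.two_mul_setLIntegral_le (hA : IsLogConcave A) (hm : Measurable A)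
    (heven : ∀ x, A (-x) = A x) (h0 : A 0 ≠ 0) (htop : A 0 ≠ ⊤) {s : ℝ} (hs : 0 ≤ s) :
    2 * ∫⁻ x in Ici 0, A x ≤
      (∫⁻ x in Ici (-s), A x) + (∫⁻ x in Ici 0, A x) / A 0 * A s := by
  have h1 : ∫⁻ x in Ici s, A x ≤ (∫⁻ x in Ici 0, A x) / A 0 * A s := by
    rw [mul_comm, ← mul_div_assoc, ENNReal.le_div_iff_mul_le (Or.inl h0) (Or.inl htop)]
    exact hA.setLIntegral_Ici_mul_le hm hs
  have split : ∀ r : ℝ, (∫⁻ x in Ici r, A x) + ∫⁻ x in Iic r, A x = ∫⁻ x, A x := by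
    intro r
    rw [← setLIntegral_congr (Iio_ae_eq_Iic (a := r)), add_comm, ← compl_Ici]
    rw [add_comm]
    exact lintegral_add_compl A measurableSet_Ici
  calc 2 * ∫⁻ x in Ici 0, A x = (∫⁻ x in Ici 0, A x) + ∫⁻ x in Iic 0, A x := by
        rw [two_mul]
        congr 1
        simpa using (setLIntegral_Iic_neg_of_even heven 0).symm
    _ = (∫⁻ x in Ici (-s), A x) + ∫⁻ x in Iic (-s), A x := by rw [split, split]
    _ ≤ _ := by
        rw [setLIntegral_Iic_neg_of_even heven]
        gcongr

end EvenLogConcave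

/-! ### Sections by parallel hyperplanes -/

section Sections

variable {d : ℕ}

/-- The volume of the section of `S` at height `x`, the height being the first coordinate. -/
noncomputable def sectionVolume (S : Set (ℝ × (Fin d → ℝ))) (x : ℝ) : ℝ≥0∞ :=
  volume (Prod.mk x ⁻¹' S)

theorem measurable_sectionVolume {S : Set (ℝ × (Fin d → ℝ))} (hS : MeasurableSet S) :
    Measurable (sectionVolume S) :=
  measurable_measure_prodMk_left hS

/-- The multiplicative Brunn–Minkowski inequality for the sections of a convex set. -/
theorem Convex.isLogConcave_sectionVolume {S : Set (ℝ × (Fin d → ℝ))} (hS : Convex ℝ S)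
    (hm : MeasurableSet S) : IsLogConcave (sectionVolume S) := by
  convert IsLogConcave.lintegral_pi d hS.isLogConcave_indicator_one
    (measurable_one.indicator hm) using 2 with x
  rw [sectionVolume, ← lintegral_indicator_one (measurable_prodMk_left hm)]
  rfl

theorem sectionVolume_neg {S : Set (ℝ × (Fin d → ℝ))} (hS : -S = S) (x : ℝ) :
    sectionVolume S (-x) = sectionVolume S x := by
  rw [sectionVolume, sectionVolume, ← Measure.measure_neg volume (Prod.mk x ⁻¹' S)]
  congr 1
  ext v
  rw [mem_neg, mem_preimage, mem_preimage]
  conv_lhs => rw [← hS, mem_neg]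
  simp

theorem sectionVolume_vadd_smul (S : Set (ℝ × (Fin d → ℝ))) (t : ℝ × (Fin d → ℝ)) {c : ℝ}
    (hc : 0 < c) (x : ℝ) :
    sectionVolume (t +ᵥ c • S) x = ENNReal.ofReal (c ^ d) * sectionVolume S ((x - t.1) / c) := by
  have : Prod.mk x ⁻¹' (t +ᵥ c • S) = t.2 +ᵥ c • (Prod.mk ((x - t.1) / c) ⁻¹' S) := by
    ext v
    rw [mem_preimage, mem_vadd_set_iff_neg_vadd_mem, mem_vadd_set_iff_neg_vadd_mem,
      mem_smul_set_iff_inv_smul_mem₀ hc.ne', mem_smul_set_iff_inv_smul_mem₀ hc.ne', mem_preimage]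
    congr! 1
    ext
    · simp
      field_simp
      ring
    · simp
      ring
  rw [sectionVolume, this, measure_vadd, Measure.addHaar_smul]
  simp [sectionVolume, abs_of_pos hc]

/-- Lebesgue measure on the upper half-space plus `m` times the Lebesgue measure of its boundary
hyperplane. -/
noncomputable def weightedHalfSpaceMeasure (d : ℕ) (m : ℝ≥0∞) : Measure (ℝ × (Fin d → ℝ)) :=
  (volume.restrict (Ici (0 : ℝ)) + m • Measure.dirac 0).prod volume

theorem weightedHalfSpaceMeasure_apply (m : ℝ≥0∞) {S : Set (ℝ × (Fin d → ℝ))}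
    (hS : MeasurableSet S) :
    weightedHalfSpaceMeasure d m S =
      (∫⁻ x in Ici 0, sectionVolume S x) + m * sectionVolume S 0 := by
  rw [weightedHalfSpaceMeasure, Measure.prod_apply hS, lintegral_add_measure,
    lintegral_smul_measure, lintegral_dirac' _ (measurable_measure_prodMk_left hS), smul_eq_mul]
  rfl

theorem weightedHalfSpaceMeasure_vadd_smul (m : ℝ≥0∞) {S : Set (ℝ × (Fin d → ℝ))}
    (hS : MeasurableSet S) (t : ℝ × (Fin d → ℝ)) {c : ℝ} (hc : 0 < c) :
    weightedHalfSpaceMeasure d m (t +ᵥ c • S) = ENNReal.ofReal (c ^ d) *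
      (ENNReal.ofReal c * (∫⁻ x in Ici (-(t.1 / c)), sectionVolume S x) +
        m * sectionVolume S (-(t.1 / c))) := by
  have hA := measurable_sectionVolume hS
  rw [weightedHalfSpaceMeasure_apply _ ((hS.const_smul₀ c).const_vadd t)]
  simp only [sectionVolume_vadd_smul S t hc]
  rw [lintegral_const_mul _ (by fun_prop), setLIntegral_Ici_eq_ofReal_mul (by fun_prop) hc t.1,
    mul_add, mul_left_comm m]
  simp [hc.ne', neg_div]

end Sections

/-! ### The volume estimate -/

/-- The upper bound for translates of an open convex body along a half-space. The translates are
compared with `(1 + 2α)U` in the measure `weightedHalfSpaceMeasure d m`, where the weight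
`m = α G / A 0`, with `A` the section volume of `U` and `G` the volume of its upper half, is the
one that gives every translate at least the measure `α ^ (d + 1) * 2G`. -/
theorem card_mul_le_of_pairwise_disjoint_translates {d n : ℕ} {U : Set (ℝ × (Fin d → ℝ))}
    (ho : IsOpen U) (hconv : Convex ℝ U) (hsymm : -U = U) (h0 : (0 : ℝ × (Fin d → ℝ)) ∈ U)
    (hbdd : Bornology.IsBounded U) {α : ℝ} (hα : 0 < α) {t : Fin n → ℝ × (Fin d → ℝ)}
    (ht : ∀ i, 0 ≤ (t i).1) (hdisj : Pairwise fun i j => Disjoint (t i +ᵥ α • U) (t j +ᵥ α • U))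
    (hsub : ∀ i, t i +ᵥ α • U ⊆ (1 + 2 * α) • U) :
    (n : ℝ) * (2 * α ^ (d + 1)) ≤ (1 + 2 * α) ^ d * (1 + 3 * α) := by
  have hm := ho.measurableSet
  set A := sectionVolume U with hA
  have hAm : Measurable A := measurable_sectionVolume hm
  have hAlog : IsLogConcave A := hconv.isLogConcave_sectionVolume hm
  have hAeven : ∀ x, A (-x) = A x := sectionVolume_neg hsymm
  have hA0 : A 0 ≠ 0 := by
    have : IsOpen (Prod.mk (0 : ℝ) ⁻¹' U) := ho.preimage (by fun_prop)
    exact (this.measure_pos volume ⟨0, h0⟩).ne'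
  have hAtop : A 0 ≠ ⊤ := by
    refine ne_top_of_le_ne_top (hbdd.image_snd.measure_lt_top (μ := volume)).ne (measure_mono ?_)
    intro v hv
    exact ⟨(0, v), hv, rfl⟩
  have hU : volume U = ∫⁻ x, A x := by
    rw [Measure.volume_eq_prod, Measure.prod_apply hm]; rfl
  set G := ∫⁻ x in Ici 0, A x with hG
  have hGtop : G ≠ ⊤ :=
    ne_top_of_le_ne_top (hU ▸ hbdd.measure_lt_top.ne) (setLIntegral_le_lintegral _ _)
  have hG0 : G ≠ 0 := by
    intro h
    refine (ho.measure_pos volume ⟨0, h0⟩).ne' ?_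
    rw [hU]
    refine le_antisymm ?_ bot_le
    calc ∫⁻ x, A x = ∫⁻ x in Iic (-0) ∪ Ici 0, A x := by simp
      _ ≤ (∫⁻ x in Iic (-0), A x) + ∫⁻ x in Ici 0, A x := lintegral_union_le _ _ _
      _ ≤ 0 := by rw [setLIntegral_Iic_neg_of_even hAeven, ← hG, h, add_zero]
  set m := ENNReal.ofReal α * (G / A 0) with hmdef
  have lower : ∀ i, ENNReal.ofReal (2 * α ^ (d + 1)) * G ≤
      weightedHalfSpaceMeasure d m (t i +ᵥ α • U) := by
    intro i
    rw [weightedHalfSpaceMeasure_vadd_smul m hm _ hα, ← hA, hmdef, hAeven, mul_assoc, ← mul_add,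
      ← mul_assoc, ← ENNReal.ofReal_mul (by positivity), ← pow_succ, mul_comm 2,
      ENNReal.ofReal_mul (by positivity), mul_assoc]
    gcongr
    simpa using hAlog.two_mul_setLIntegral_le hAm hAeven hA0 hAtop (div_nonneg (ht i) hα.le)
  have upper : weightedHalfSpaceMeasure d m ((1 + 2 * α) • U) =
      ENNReal.ofReal ((1 + 2 * α) ^ d * (1 + 3 * α)) * G := by
    have := weightedHalfSpaceMeasure_vadd_smul m hm 0 (c := 1 + 2 * α) (by positivity)
    simp only [zero_vadd, Prod.fst_zero, zero_div, neg_zero] at this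
    rw [this, ← hA, hmdef, mul_assoc (ENNReal.ofReal α), ENNReal.div_mul_cancel hA0 hAtop, ← hG,
      ← add_mul, ← ENNReal.ofReal_add (by positivity) hα.le, ← mul_assoc,
      ← ENNReal.ofReal_mul (by positivity)]
    ring_nf
  have main : (n : ℝ≥0∞) * (ENNReal.ofReal (2 * α ^ (d + 1)) * G) ≤
      ENNReal.ofReal ((1 + 2 * α) ^ d * (1 + 3 * α)) * G := by
    calc (n : ℝ≥0∞) * (ENNReal.ofReal (2 * α ^ (d + 1)) * G)
        = ∑ _i : Fin n, ENNReal.ofReal (2 * α ^ (d + 1)) * G := by simp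
      _ ≤ ∑ i, weightedHalfSpaceMeasure d m (t i +ᵥ α • U) := Finset.sum_le_sum fun i _ => lower i
      _ = weightedHalfSpaceMeasure d m (⋃ i, t i +ᵥ α • U) := by
          rw [measure_iUnion hdisj fun i => (hm.const_smul₀ α).const_vadd (t i), tsum_fintype]
      _ ≤ weightedHalfSpaceMeasure d m ((1 + 2 * α) • U) := measure_mono (iUnion_subset hsub)
      _ = _ := upper
  rw [← mul_assoc, ENNReal.mul_le_mul_iff_left hG0 hGtop, ← ENNReal.ofReal_natCast,
    ← ENNReal.ofReal_mul (by positivity)] at main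
  exact (ENNReal.ofReal_le_ofReal_iff (by positivity)).1 main

/-! ### Reduction to a bounded open convex set and a coordinate half-space -/

theorem exists_ne_zero_forall_nonneg_of_zero_notMem_interior_convexHull {E : Type*}
    [NormedAddCommGroup E] [NormedSpace ℝ E] [FiniteDimensional ℝ E] [Nontrivial E] {s : Set E}
    (hs : (0 : E) ∉ interior (convexHull ℝ s)) :
    ∃ f : E →L[ℝ] ℝ, f ≠ 0 ∧ ∀ x ∈ s, 0 ≤ f x := by
  by_cases hne : (interior (convexHull ℝ s)).Nonempty
  · obtain ⟨f, hf⟩ := geometric_hahn_banach_point_open (convex_convexHull ℝ s).interior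
      isOpen_interior hs
    simp only [map_zero] at hf
    refine ⟨f, ?_, fun x hx => ?_⟩
    · rintro rfl
      obtain ⟨y, hy⟩ := hne
      simpa using hf y hy
    · have hx' : x ∈ closure (interior (convexHull ℝ s)) := by
        rw [(convex_convexHull ℝ s).closure_interior_eq_closure_of_nonempty_interior hne]
        exact subset_closure (subset_convexHull ℝ s hx)
      exact closure_minimal (fun y hy => (hf y hy).le) (isClosed_Ici.preimage f.continuous) hx'
  · -- without interior points, `s` lies in a hyperplane `f = const`
    have haff : affineSpan ℝ s ≠ ⊤ := fun h =>
      hne (interior_convexHull_nonempty_iff_affineSpan_eq_top.2 h)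
    rcases s.eq_empty_or_nonempty with rfl | ⟨p, hp⟩
    · obtain ⟨v, hv⟩ := exists_ne (0 : E)
      obtain ⟨f, hf⟩ := SeparatingDual.exists_ne_zero (R := ℝ) hv
      exact ⟨f, fun h => hf (by simp [h]), by simp⟩
    have hlt : (affineSpan ℝ s).direction < ⊤ := lt_top_iff_ne_top.2 fun h =>
      haff ((AffineSubspace.direction_eq_top_iff_of_nonempty
        ⟨p, subset_affineSpan ℝ s hp⟩).1 h)
    obtain ⟨g, hg0, hg⟩ := Submodule.exists_le_ker_of_lt_top _ hlt
    have hconst : ∀ x ∈ s, g x = g p := by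
      intro x hx
      have := hg (AffineSubspace.vsub_mem_direction (subset_affineSpan ℝ s hx)
        (subset_affineSpan ℝ s hp))
      rw [LinearMap.mem_ker, vsub_eq_sub, map_sub] at this
      linarith
    have hg0' : LinearMap.toContinuousLinearMap g ≠ 0 := by simpa using hg0
    rcases le_total 0 (g p) with h | h
    · exact ⟨LinearMap.toContinuousLinearMap g, hg0', fun x hx => by simpa [hconst x hx] using h⟩
    · exact ⟨-LinearMap.toContinuousLinearMap g, neg_ne_zero.2 hg0',
        fun x hx => by simpa [hconst x hx] using h⟩

/-- A non-zero functional is the first coordinate of a suitable linear coordinate system. -/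
theorem exists_continuousLinearEquiv_fst_eq {E : Type*} [NormedAddCommGroup E] [NormedSpace ℝ E]
    [FiniteDimensional ℝ E] {d : ℕ} (hd : Module.finrank ℝ E = d + 1) {f : E →L[ℝ] ℝ}
    (hf : f ≠ 0) : ∃ L : E ≃L[ℝ] ℝ × (Fin d → ℝ), ∀ x, (L x).1 = f x := by
  obtain ⟨v, hv⟩ : ∃ v, f v ≠ 0 := by
    by_contra! h
    exact hf (ContinuousLinearMap.ext h)
  have hinv : Function.RightInverse (ContinuousLinearMap.toSpanSingleton ℝ ((f v)⁻¹ • v)) f := by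
    intro r
    simp [hv]
  have hker : Module.finrank ℝ f.ker = Module.finrank ℝ (Fin d → ℝ) := by
    have h1 := LinearMap.finrank_range_add_finrank_ker (f : E →ₗ[ℝ] ℝ)
    have h2 : LinearMap.range (f : E →ₗ[ℝ] ℝ) = ⊤ :=
      LinearMap.range_eq_top.2 hinv.surjective
    rw [h2, finrank_top, Module.finrank_self, hd] at h1
    rw [Module.finrank_fin_fun]
    exact Nat.add_left_cancel (h1.trans (add_comm _ _))
  exact ⟨(ContinuousLinearEquiv.equivOfRightInverse f _ hinv).trans
    ((ContinuousLinearEquiv.refl ℝ ℝ).prodCongr (ContinuousLinearEquiv.ofFinrankEq hker)),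
    fun x => by simp⟩

theorem image_vadd_smul {E F : Type*} [NormedAddCommGroup E] [NormedSpace ℝ E]
    [NormedAddCommGroup F] [NormedSpace ℝ F] (L : E ≃L[ℝ] F) (t : E)
    (c : ℝ) (s : Set E) : L '' (t +ᵥ c • s) = L t +ᵥ c • L '' s := by
  simp only [← image_vadd, ← image_smul, image_image, vadd_eq_add, map_add, map_smul]

theorem Convex.vadd_smul_interior_subset {E : Type*} [NormedAddCommGroup E] [NormedSpace ℝ E]
    {K : Set E} (hK : Convex ℝ K) (hsymm : -K = K) {α : ℝ} (hα : 0 < α) {t p k : E} (hp : p ∈ K)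
    (hk : k ∈ K) (htp : t + α • k = p) :
    t +ᵥ α • interior K ⊆ (1 + 2 * α) • interior K := by
  rintro _ ⟨_, ⟨u, hu, rfl⟩, rfl⟩
  have hk' : -k ∈ K := by rw [← hsymm]; simpa using hk
  have h1 : (0 : ℝ) < 1 + α := by positivity
  have h2 : (0 : ℝ) < 1 + 2 * α := by positivity
  have hq : (1 / (1 + α)) • p + (α / (1 + α)) • (-k) ∈ K :=
    hK hp hk' (by positivity) (by positivity) (by field_simp)
  have hr := hK.combo_self_interior_mem_interior hq hu
    (show (0 : ℝ) ≤ (1 + α) / (1 + 2 * α) by positivity)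
    (show (0 : ℝ) < α / (1 + 2 * α) by positivity) (by field_simp; ring)
  refine ⟨_, hr, ?_⟩
  simp only [vadd_eq_add, smul_add, smul_smul]
  rw [show (1 + 2 * α) * ((1 + α) / (1 + 2 * α) * (1 / (1 + α))) = 1 by field_simp,
    show (1 + 2 * α) * ((1 + α) / (1 + 2 * α) * (α / (1 + α))) = α by field_simp,
    show (1 + 2 * α) * (α / (1 + 2 * α)) = α by field_simp, ← htp]
  module

/-- The upper bound. Only finitely many points of `K` witness that the translates meet `K`, so `K`
may be cut down to its intersection with a large ball. -/
theorem IsOneSidedArrangement.card_mul_le {d n : ℕ} {K : Set (EuclideanSpace ℝ (Fin (d + 1)))}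
    {α : ℝ} {t : Fin n → EuclideanSpace ℝ (Fin (d + 1))} (hK : IsSymmConvexSet K) (hα : 0 < α)
    (ht : IsOneSidedArrangement K α t) :
    (n : ℝ) * (2 * α ^ (d + 1)) ≤ (1 + 2 * α) ^ d * (1 + 3 * α) := by
  obtain ⟨f, hf0, hf⟩ :=
    exists_ne_zero_forall_nonneg_of_zero_notMem_interior_convexHull ht.oneSided
  obtain ⟨L, hL⟩ := exists_continuousLinearEquiv_fst_eq (d := d) (by simp) hf0
  have hwit : ∀ i, ∃ k ∈ K, t i + α • k ∈ K := by
    intro i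
    obtain ⟨_, ⟨_, ⟨k, hk, rfl⟩, rfl⟩, hp⟩ := ht.meets i
    exact ⟨k, hk, hp⟩
  choose k hk hp using hwit
  obtain ⟨z, hz⟩ := hK.interior_nonempty
  obtain ⟨R, hR⟩ := (((finite_range k).union (finite_range fun i => t i + α • k i)).union
    (finite_singleton z)).isBounded.subset_ball 0
  set K' := K ∩ Metric.ball 0 R with hK'
  have hconv : Convex ℝ K' := hK.convex.inter (convex_ball 0 R)
  have hsymm : -K' = K' := by rw [hK', inter_neg, hK.symm, neg_ball, neg_zero]
  have hint : interior K' = interior K ∩ Metric.ball 0 R := by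
    rw [hK', interior_inter, Metric.isOpen_ball.interior_eq]
  have hzmem : z ∈ interior K' := hint ▸ ⟨hz, hR (by simp)⟩
  have hsymmI : -interior K' = interior K' := by
    conv_rhs => rw [← hsymm]
    exact (Homeomorph.neg _).preimage_interior K'
  have h0 : (0 : EuclideanSpace ℝ (Fin (d + 1))) ∈ interior K' := by
    have hz' : -z ∈ interior K' := by rw [← hsymmI]; simpa using hzmem
    have := hconv.interior hzmem hz' (show (0 : ℝ) ≤ 1 / 2 by norm_num)
      (show (0 : ℝ) ≤ 1 / 2 by norm_num) (by norm_num)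
    simpa using this
  have himg : ∀ i, L (t i) +ᵥ α • L '' interior K' = L '' (t i +ᵥ α • interior K') := fun i =>
    (image_vadd_smul L _ _ _).symm
  refine card_mul_le_of_pairwise_disjoint_translates (U := L '' interior K')
    (L.toHomeomorph.isOpenMap _ isOpen_interior)
    (hconv.interior.linear_image (L : EuclideanSpace ℝ (Fin (d + 1)) →ₗ[ℝ] ℝ × (Fin d → ℝ)))
    ?_ ⟨0, h0, map_zero L⟩ ?_ hα (t := fun i => L (t i)) ?_ ?_ ?_
  · rw [← image_neg_eq_neg, image_image]
    conv_rhs => rw [← hsymmI, ← image_neg_eq_neg, image_image]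
    simp
  · exact L.lipschitz.isBounded_image
      (Metric.isBounded_ball.subset (interior_subset.trans inter_subset_right))
  · exact fun i => hL (t i) ▸ hf _ (mem_range_self i)
  · intro i j hij
    have hle : ∀ i, t i +ᵥ α • interior K' ⊆ interior (t i +ᵥ α • K) := fun i =>
      interior_maximal (vadd_set_mono (smul_set_mono (interior_subset.trans inter_subset_left)))
        ((isOpen_interior.smul₀ hα.ne').vadd (t i))
    simp only [himg]
    exact disjoint_image_of_injective L.injective ((ht.nonOverlapping i j hij).mono (hle i) (hle j))
  · intro i
    rw [himg]
    have := hconv.vadd_smul_interior_subset hsymm hα (t := t i) (p := t i + α • k i) (k := k i)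
      ⟨hp i, hR (by simp)⟩ ⟨hk i, hR (by simp)⟩ rfl
    refine (image_mono this).trans (le_of_eq ?_)
    simp

/-! ### The cube -/

section Cube

variable {D : ℕ}

/-- The cube `[-1, 1] ^ D`. -/
def symmCube (D : ℕ) : Set (EuclideanSpace ℝ (Fin D)) := {x | ∀ i, |x i| ≤ 1}

theorem isSymmConvexSet_symmCube (D : ℕ) : IsSymmConvexSet (symmCube D) where
  convex := by
    intro x hx y hy a b ha hb hab i
    have h1 := abs_le.1 (hx i)
    have h2 := abs_le.1 (hy i)
    simp only [PiLp.add_apply, PiLp.smul_apply, smul_eq_mul]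
    rw [abs_le]
    constructor <;> nlinarith
  symm := by
    ext x
    simp [symmCube]
  interior_nonempty := by
    refine ⟨0, mem_interior.2 ⟨{x | ∀ i, |x i| < 1}, fun x hx i => (hx i).le, ?_, by simp⟩⟩
    simp only [ofPred_forall]
    exact isOpen_iInter_of_finite fun i => isOpen_lt (by fun_prop) continuous_const

theorem isCompact_symmCube (D : ℕ) : IsCompact (symmCube D) := by
  refine Metric.isCompact_of_isClosed_isBounded ?_ ?_
  · simp only [symmCube, ofPred_forall]
    exact isClosed_iInter fun i => isClosed_le (by fun_prop) continuous_const
  · refine (EuclideanSpace.equiv (Fin D) ℝ).antilipschitz.isBounded_preimage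
      (s := Metric.closedBall 0 1) Metric.isBounded_closedBall |>.subset ?_
    intro x hx
    simp only [mem_preimage, mem_closedBall_zero_iff]
    exact (pi_norm_le_iff_of_nonneg zero_le_one).2 hx

theorem abs_sub_lt_one_of_mem_interior_vadd_symmCube {t x : EuclideanSpace ℝ (Fin D)}
    (hx : x ∈ interior (t +ᵥ symmCube D)) (i : Fin D) : |x i - t i| < 1 := by
  have hopen : IsOpenMap fun y : EuclideanSpace ℝ (Fin D) => y i :=
    (EuclideanSpace.proj i : EuclideanSpace ℝ (Fin D) →L[ℝ] ℝ).isOpenMap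
      fun r => ⟨EuclideanSpace.single i r, by simp⟩
  have hsub : (fun y : EuclideanSpace ℝ (Fin D) => y i) '' interior (t +ᵥ symmCube D) ⊆
      interior (Icc (t i - 1) (t i + 1)) := by
    refine interior_maximal ?_ (hopen _ isOpen_interior)
    rintro _ ⟨y, hy, rfl⟩
    obtain ⟨z, hz, rfl⟩ := interior_subset hy
    have := abs_le.1 (hz i)
    simp only [vadd_eq_add, PiLp.add_apply, mem_Icc]
    constructor <;> linarith
  have := hsub ⟨x, hx, rfl⟩
  rw [interior_Icc, mem_Ioo] at this
  rw [abs_lt]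
  constructor <;> linarith [this.1, this.2]

/-- The vectors whose first coordinate is `0` or `2` and whose other coordinates are
`-2`, `0` or `2`. -/
noncomputable def cubeTranslation (d : ℕ) (c : Fin 2 × (Fin d → Fin 3)) :
    EuclideanSpace ℝ (Fin (d + 1)) :=
  WithLp.toLp 2 (Fin.cons (2 * (c.1 : ℝ)) fun i => 2 * (c.2 i : ℝ) - 2)

theorem abs_cubeTranslation_le (d : ℕ) (c : Fin 2 × (Fin d → Fin 3)) (i : Fin (d + 1)) :
    |cubeTranslation d c i| ≤ 2 := by
  refine Fin.cases ?_ (fun j => ?_) i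
  · have : ((c.1 : ℕ) : ℝ) ≤ 1 := by exact_mod_cast Nat.lt_succ_iff.1 c.1.2
    simp only [cubeTranslation, Fin.cons_zero]
    rw [abs_le]
    constructor <;> linarith [Nat.cast_nonneg (α := ℝ) (c.1 : ℕ)]
  · have : ((c.2 j : ℕ) : ℝ) ≤ 2 := by exact_mod_cast Nat.lt_succ_iff.1 (c.2 j).2
    simp only [cubeTranslation, Fin.cons_succ]
    rw [abs_le]
    constructor <;> linarith [Nat.cast_nonneg (α := ℝ) (c.2 j : ℕ)]

theorem exists_two_le_abs_cubeTranslation_sub {d : ℕ} {c c' : Fin 2 × (Fin d → Fin 3)}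
    (h : c ≠ c') : ∃ i, 2 ≤ |cubeTranslation d c i - cubeTranslation d c' i| := by
  have key : ∀ {m : ℕ} {p q : Fin m}, p ≠ q → (1 : ℝ) ≤ |((p : ℕ) : ℝ) - ((q : ℕ) : ℝ)| := by
    intro m p q hpq
    have : ((p : ℕ) : ℤ) - ((q : ℕ) : ℤ) ≠ 0 := by
      have := Fin.val_ne_of_ne hpq
      omega
    exact_mod_cast Int.one_le_abs this
  by_cases h1 : c.1 = c'.1
  · obtain ⟨j, hj⟩ : ∃ j, c.2 j ≠ c'.2 j := by
      by_contra! h2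
      exact h (Prod.ext h1 (funext h2))
    refine ⟨j.succ, ?_⟩
    have := key hj
    simp only [cubeTranslation, Fin.cons_succ]
    rw [sub_sub_sub_cancel_right, ← mul_sub, abs_mul, abs_two]
    linarith
  · refine ⟨0, ?_⟩
    have := key h1
    simp only [cubeTranslation, Fin.cons_zero]
    rw [← mul_sub, abs_mul, abs_two]
    linarith

theorem isOneSidedArrangement_cubeTranslation {d n : ℕ} (e : Fin n ≃ Fin 2 × (Fin d → Fin 3)) :
    IsOneSidedArrangement (symmCube (d + 1)) 1 fun i => cubeTranslation d (e i) where
  nonOverlapping := by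
    intro i j hij
    rw [one_smul, NonOverlapping, Set.disjoint_left]
    intro x hx hy
    obtain ⟨l, hl⟩ := exists_two_le_abs_cubeTranslation_sub (e.injective.ne hij)
    have h1 := abs_lt.1 (abs_sub_lt_one_of_mem_interior_vadd_symmCube hx l)
    have h2 := abs_lt.1 (abs_sub_lt_one_of_mem_interior_vadd_symmCube hy l)
    rcases le_abs.1 hl with h | h <;> linarith [h1.1, h1.2, h2.1, h2.2]
  meets := by
    intro i
    -- the midpoint of the two centres lies in both cubes
    have hmid : (1 / 2 : ℝ) • cubeTranslation d (e i) ∈ symmCube (d + 1) := by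
      intro l
      have := abs_cubeTranslation_le d (e i) l
      rw [PiLp.smul_apply, smul_eq_mul, abs_mul, abs_of_pos (by norm_num : (0 : ℝ) < 1 / 2)]
      linarith
    refine ⟨(1 / 2 : ℝ) • cubeTranslation d (e i), ?_, hmid⟩
    rw [one_smul]
    refine ⟨-((1 / 2 : ℝ) • cubeTranslation d (e i)), ?_, ?_⟩
    · rw [← (isSymmConvexSet_symmCube (d + 1)).symm]
      simpa using hmid
    · simp only [vadd_eq_add]
      module
  oneSided := by
    intro h
    have hopen : IsOpenMap fun y : EuclideanSpace ℝ (Fin (d + 1)) => y 0 :=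
      (EuclideanSpace.proj 0 : EuclideanSpace ℝ (Fin (d + 1)) →L[ℝ] ℝ).isOpenMap
        fun r => ⟨EuclideanSpace.single 0 r, by simp⟩
    have hsub : convexHull ℝ (range fun i => cubeTranslation d (e i)) ⊆
        {y : EuclideanSpace ℝ (Fin (d + 1)) | 0 ≤ y 0} := by
      refine convexHull_min ?_ ?_
      · rintro _ ⟨i, rfl⟩
        simp [cubeTranslation]
      · intro x hx y hy a b ha hb _
        simp only [mem_ofPred_eq] at hx hy ⊢
        simp only [PiLp.add_apply, PiLp.smul_apply, smul_eq_mul]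
        positivity
    have h' : (0 : ℝ) ∈ interior (Ici (0 : ℝ)) := by
      refine interior_maximal ?_ (hopen _ isOpen_interior) ⟨0, h, by simp⟩
      rintro _ ⟨y, hy, rfl⟩
      exact hsub (interior_subset hy)
    simp at h'

end Cube

/-! ### The bound and its sharpness -/

theorem mainTheorem3 (D : ℕ) (hD : 2 ≤ D) :
    (∀ (K : Set (EuclideanSpace ℝ (Fin D))) (α : ℝ) (n : ℕ)
        (t : Fin n → EuclideanSpace ℝ (Fin D)),
        IsSymmConvexSet K → 0 < α → IsOneSidedArrangement K α t →
          (n : ℝ) ≤ oneSidedBound D α) ∧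
    (∃ (K : Set (EuclideanSpace ℝ (Fin D))) (n : ℕ) (t : Fin n → EuclideanSpace ℝ (Fin D)),
        IsSymmConvexSet K ∧ IsCompact K ∧ IsOneSidedArrangement K 1 t ∧
          (n : ℝ) = oneSidedBound D 1) := by
  obtain ⟨d, rfl⟩ : ∃ d, D = d + 1 := ⟨D - 1, by omega⟩
  have hcard : Fintype.card (Fin 2 × (Fin d → Fin 3)) = 2 * 3 ^ d := by simp
  have e := (Fintype.equivFin (Fin 2 × (Fin d → Fin 3))).symm
  refine ⟨fun K α n t hK hα ht => ?_, symmCube (d + 1), _, _, isSymmConvexSet_symmCube _,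
    isCompact_symmCube _, isOneSidedArrangement_cubeTranslation e, ?_⟩
  · rw [oneSidedBound, le_div_iff₀ (by positivity)]
    exact ht.card_mul_le hK hα
  · rw [hcard, oneSidedBound, Nat.add_sub_cancel]
    push_cast
    norm_num
    ring
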